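/- Let $q$ be a power of a prime $p$, and let $u$ and $r$ be positive integers such that $u+2<r$, $\gcd(u,q)=1$, $(r+1)\mid(q-1)$, and $\gcd(u,q-1)$ divides $\frac{2(q-1)}{r+1}$. Then there exists a $[[n,\kappa,\delta]]_q$ quantum stabilizer code $\mathcal{Q}$ with locality $r$, where $$n=u(r+1),\qquad \kappa=u(r-1)-2,\qquad \delta=3,$$ that arises from the CSS construction below and is optimal with respect to the quantum Singleton-like bound $2\delta\le n-\kappa-2\lceil \kappa/r\rceil+4$, that is, it satisfies $$2\delta= n-\kappa-2\left\lceil \frac{\kappa}{r}\right\rceil+4 .$$ Here the terms have the following meaning. Let $(\mathbb{C}^q)^{\otimes n}$ have orthonormal basis $|\mathbf z\rangle$, $\mathbf z\in\mathbb{F}_q^n$, let $\xi_p=e^{2\pi\sqrt{-1}/p}$, and put $X(\mathbf a)|\mathbf z\rangle=|\mathbf z+\mathbf a\rangle$ and $Z(\mathbf b)|\mathbf z\rangle=\xi_p^{\mathrm{tr}\langle\mathbf b,\mathbf z\rangle}|\mathbf z\rangle$, with $\mathrm{tr}:\mathbb{F}_q\to\mathbb{F}_p$ the trace. The error operators $\xi_p^iX(\mathbf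 a)Z(\mathbf b)$ form a group $\mathcal{E}_n$; the support of such an operator is $\{i:a_i\ne0\text{ or }b_i\neq0\}$, and its weight is the size of its support. For an abelian subgroup $G\le\mathcal{E}_n$, the stabilizer code $\mathcal{Q}(G)$ is the space of vectors fixed by every element of $G$. * $\mathcal{Q}=\mathcal{Q}(G)$ is an $[[n,\kappa,\delta]]_q$ code if $\dim_{\mathbb{C}}\mathcal{Q}=q^\kappa$ and $\mathcal{Q}$ detects every error operator of weight less than $\delta$ but not every one of weight $\delta$. Here $\mathcal{Q}$ detects $E$ if there is a scalar $\lambda_E$ with $\langle\varphi|E|\psi\rangle=\lambda_E\langle\varphi|\psi\rangle$ for all $\varphi,\psi\in\mathcal{Q}$. * $\mathcal{Q}(G)$ has locality $r$ if for each $i\in\{1,\dots,n\}$ there are $E_1=X(\mathbf a)Z(\mathbf b)$ and $E_2=X(\mathbf x)Z(\mathbf y)$ in $G$ with $(a_i,b_i)=(1,0)$, $(x_i,y_i)=(0,1)$, and $|\mathrm{supp}(E_1)\cup\mathrm{supp}(E_2)|\le r+1$. * $\mathcal{Q}(G)$ arises from the CSS construction (with locality $r$) if $G=\{X(\mathbf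 a)Z(\mathbf b):\mathbf a\in\mathcal{C}_1^\perp,\ \mathbf b\in\mathcal{C}_2^\perp\}$ for linear codes $\mathcal{C}_1,\mathcal{C}_2\subseteq\mathbb{F}_q^n$ with $\mathcal{C}_1^\perp\subsetneq\mathcal{C}_2$, such that for each $j\in\{1,\dots,n\}$ there are $\mathbf c_1\in\mathcal{C}_1^\perp$ and $\mathbf c_2\in\mathcal{C}_2^\perp$ with $j\in\mathrm{supp}(\mathbf c_1)\cap\mathrm{supp}(\mathbf c_2)$ and $|\mathrm{supp}(\mathbf c_1)\cup\mathrm{supp}(\mathbf c_2)|\le r+1$. -/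

import Mathlib

set_option linter.unusedSectionVars false

noncomputable section

namespace QLRC

/-- The complex Hilbert space `(ℂ^q)^{⊗ n}` of `n` qudits over the finite field `F` of order `q`,
with orthonormal basis `|z⟩`, `z ∈ F^n`; a vector is given by its coordinates in this basis. -/
abbrev Qudits (F : Type*) [Fintype F] (n : ℕ) : Type _ := EuclideanSpace ℂ (Fin n → F)

section Operators

variable {F : Type*} [Field F] [Fintype F] {n : ℕ}

/-- The operator `X(a) : |z⟩ ↦ |z + a⟩`. -/
def opX (a : Fin n → F) : Qudits F n ≃ₗ[ℂ] Qudits F n where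
  toFun ψ := WithLp.toLp 2 fun z => ψ (z - a)
  invFun ψ := WithLp.toLp 2 fun z => ψ (z + a)
  map_add' _ _ := by ext z; simp
  map_smul' _ _ := by ext z; simp
  left_inv _ := by ext z; simp
  right_inv _ := by ext z; simp

/-- The scalar `ξ_p ^ tr(⟨b, z⟩)`, where `ξ_p = exp(2πi/p)` and `tr` is the trace `F → 𝔽_p`. -/
def phase (p : ℕ) [Fact p.Prime] [Algebra (ZMod p) F] (b z : Fin n → F) : ℂ :=
  ZMod.stdAddChar (Algebra.trace (ZMod p) F (b ⬝ᵥ z))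

theorem phase_add_left (p : ℕ) [Fact p.Prime] [Algebra (ZMod p) F] (b c z : Fin n → F) :
    phase p (b + c) z = phase p b z * phase p c z := by
  simp [phase, add_dotProduct, AddChar.map_add_eq_mul]

theorem phase_zero_left (p : ℕ) [Fact p.Prime] [Algebra (ZMod p) F] (z : Fin n → F) :
    phase p 0 z = 1 := by
  simp [phase]

/-- The operator `Z(b) : |z⟩ ↦ ξ_p ^ tr(⟨b, z⟩) |z⟩`. -/
def opZ (p : ℕ) [Fact p.Prime] [Algebra (ZMod p) F] (b : Fin n → F) :
    Qudits F n ≃ₗ[ℂ] Qudits F n where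
  toFun ψ := WithLp.toLp 2 fun z => phase p b z * ψ z
  invFun ψ := WithLp.toLp 2 fun z => phase p (-b) z * ψ z
  map_add' _ _ := by ext z; simp [mul_add]
  map_smul' _ _ := by ext z; simp [mul_left_comm]
  left_inv _ := by ext z; simp [← mul_assoc, ← phase_add_left, phase_zero_left]
  right_inv _ := by ext z; simp [← mul_assoc, ← phase_add_left, phase_zero_left]

/-- The scalar operator `ξ_p ^ i`. -/
def opScalar (F : Type*) [Field F] [Fintype F] (n p : ℕ) [Fact p.Prime] (i : ZMod p) :
    Qudits F n ≃ₗ[ℂ] Qudits F n :=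
  LinearEquiv.smulOfNeZero ℂ (Qudits F n) (ZMod.stdAddChar i : ℂ)
    ((AddChar.val_isUnit ZMod.stdAddChar i).ne_zero)

/-- The error operator `ξ_p ^ i X(a) Z(b)`. -/
def errorOp (p : ℕ) [Fact p.Prime] [Algebra (ZMod p) F] (i : ZMod p) (a b : Fin n → F) :
    Qudits F n ≃ₗ[ℂ] Qudits F n :=
  opScalar F n p i * opX a * opZ p b

theorem errorOp_apply (p : ℕ) [Fact p.Prime] [Algebra (ZMod p) F] (i : ZMod p)
    (a b : Fin n → F) (ψ : Qudits F n) (z : Fin n → F) :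
    errorOp p i a b ψ z = ZMod.stdAddChar i * (phase p b (z - a) * ψ (z - a)) := by
  simp [errorOp, opScalar, opX, opZ, LinearEquiv.smulOfNeZero]
  rfl

theorem errorOp_mul (p : ℕ) [Fact p.Prime] [Algebra (ZMod p) F] (i j : ZMod p)
    (a b c d : Fin n → F) :
    errorOp p i a b * errorOp p j c d =
      errorOp p (i + j + Algebra.trace (ZMod p) F (b ⬝ᵥ c)) (a + c) (b + d) := by
  ext ψ z
  have h : z - (a + c) = z - a - c := by abel
  have h2 : phase p b (z - a) = phase p b (z - a - c) * phase p b c := by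
    simp [phase, dotProduct_sub, ← AddChar.map_add_eq_mul]
  have h3 : (ZMod.stdAddChar (Algebra.trace (ZMod p) F (b ⬝ᵥ c)) : ℂ) = phase p b c := rfl
  rw [LinearEquiv.mul_apply, errorOp_apply, errorOp_apply, errorOp_apply, h, h2, phase_add_left,
    AddChar.map_add_eq_mul, AddChar.map_add_eq_mul, h3]
  ring

theorem errorOp_one (p : ℕ) [Fact p.Prime] [Algebra (ZMod p) F] :
    errorOp p 0 (0 : Fin n → F) 0 = 1 := by
  ext ψ z
  rw [errorOp_apply]
  simp [phase_zero_left]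

/-- The group `𝓔_n` of quantum error operators. -/
def errorGroup (F : Type*) [Field F] [Fintype F] (n p : ℕ) [Fact p.Prime] [Algebra (ZMod p) F] :
    Subgroup (Qudits F n ≃ₗ[ℂ] Qudits F n) where
  carrier := {E | ∃ (i : ZMod p) (a b : Fin n → F), E = errorOp p i a b}
  mul_mem' := by
    rintro _ _ ⟨i, a, b, rfl⟩ ⟨j, c, d, rfl⟩
    exact ⟨_, _, _, errorOp_mul p i j a b c d⟩
  one_mem' := ⟨0, 0, 0, (errorOp_one p).symm⟩
  inv_mem' := by
    rintro _ ⟨i, a, b, rfl⟩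
    refine ⟨-i + Algebra.trace (ZMod p) F (b ⬝ᵥ a), -a, -b, ?_⟩
    rw [inv_eq_iff_mul_eq_one, errorOp_mul, ← errorOp_one p]
    congr 1 <;> simp

/-- `supp_Q(ξ_p ^ i X(a) Z(b)) = {i : a_i ≠ 0 or b_i ≠ 0}`. -/
def qsupp (a b : Fin n → F) : Set (Fin n) := {i | a i ≠ 0 ∨ b i ≠ 0}

end Operators

section Codes

variable {F : Type*} [Field F] [Fintype F] {n : ℕ}

/-- The group `G` is an abelian subgroup of the error group `𝓔_n`. -/
def IsStabilizerGroup (p : ℕ) [Fact p.Prime] [Algebra (ZMod p) F]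
    (G : Subgroup (Qudits F n ≃ₗ[ℂ] Qudits F n)) : Prop :=
  G ≤ errorGroup F n p ∧ ∀ E₁ ∈ G, ∀ E₂ ∈ G, E₁ * E₂ = E₂ * E₁

/-- The stabilizer code `Q(G)`: the vectors fixed by every operator in `G`. -/
def stabilizerCode (G : Subgroup (Qudits F n ≃ₗ[ℂ] Qudits F n)) : Submodule ℂ (Qudits F n) where
  carrier := {ψ | ∀ E ∈ G, E ψ = ψ}
  add_mem' h₁ h₂ E hE := by rw [map_add, h₁ E hE, h₂ E hE]
  zero_mem' E _ := map_zero E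
  smul_mem' c ψ h E hE := by rw [map_smul, h E hE]

/-- The code `Q` detects the operator `E`: `⟨φ|E|ψ⟩ = λ ⟨φ|ψ⟩` for all `φ, ψ ∈ Q`, with `λ`
depending on `E` alone. -/
def Detects (Q : Submodule ℂ (Qudits F n)) (E : Qudits F n ≃ₗ[ℂ] Qudits F n) : Prop :=
  ∃ lam : ℂ, ∀ φ ∈ Q, ∀ ψ ∈ Q, inner ℂ φ (E ψ) = lam * inner ℂ φ ψ

/-- The code `Q` has minimum distance `δ`: it detects all error operators of weight less than `δ`,
but not all those of weight `δ`. -/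
def HasMinDist (p : ℕ) [Fact p.Prime] [Algebra (ZMod p) F] (Q : Submodule ℂ (Qudits F n))
    (δ : ℕ) : Prop :=
  (∀ (i : ZMod p) (a b : Fin n → F), (qsupp a b).ncard < δ → Detects Q (errorOp p i a b)) ∧
  ∃ (i : ZMod p) (a b : Fin n → F), (qsupp a b).ncard = δ ∧ ¬ Detects Q (errorOp p i a b)

/-- `Q` is an `[[n, κ, δ]]_q` quantum code, where `q` is the order of `F`. -/
def IsQuantumCode (p : ℕ) [Fact p.Prime] [Algebra (ZMod p) F] (Q : Submodule ℂ (Qudits F n))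
    (κ δ : ℕ) : Prop :=
  Module.finrank ℂ Q = Fintype.card F ^ κ ∧ HasMinDist p Q δ

/-- The stabilizer code `Q(G)` is locally recoverable with locality `r`: every position `i` carries
stabilizers `X(a) Z(b)` and `X(x) Z(y)` with `(a_i, b_i) = (1, 0)` and `(x_i, y_i) = (0, 1)` that
together involve `i` and at most `r` other positions. -/
def HasLocality (p : ℕ) [Fact p.Prime] [Algebra (ZMod p) F]
    (G : Subgroup (Qudits F n ≃ₗ[ℂ] Qudits F n)) (r : ℕ) : Prop :=
  ∀ i : Fin n, ∃ a b x y : Fin n → F,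
    opX a * opZ p b ∈ G ∧ opX x * opZ p y ∈ G ∧
    (qsupp a b ∪ qsupp x y).ncard ≤ r + 1 ∧
    (a i = 1 ∧ b i = 0) ∧ (x i = 0 ∧ y i = 1)

/-- The (Euclidean) dual of a linear code. -/
def dualCode (C : Submodule F (Fin n → F)) : Submodule F (Fin n → F) where
  carrier := {a | ∀ c ∈ C, a ⬝ᵥ c = 0}
  add_mem' h₁ h₂ c hc := by rw [add_dotProduct, h₁ c hc, h₂ c hc, add_zero]
  zero_mem' c _ := zero_dotProduct c
  smul_mem' t a h c hc := by rw [smul_dotProduct, h c hc, smul_zero]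

/-- `G` is the stabilizer group `{X(a) Z(b) : a ∈ C₁^⊥, b ∈ C₂^⊥}` of the CSS construction from
linear codes with `C₁^⊥ ⊊ C₂`, such that every position `j` lies in the supports of some
`c₁ ∈ C₁^⊥` and `c₂ ∈ C₂^⊥` whose supports together have at most `r + 1` elements. -/
def IsCSSWithLocality (p : ℕ) [Fact p.Prime] [Algebra (ZMod p) F]
    (G : Subgroup (Qudits F n ≃ₗ[ℂ] Qudits F n)) (r : ℕ) : Prop :=
  ∃ C₁ C₂ : Submodule F (Fin n → F),
    dualCode C₁ < C₂ ∧
    (∀ j : Fin n, ∃ c₁ ∈ dualCode C₁, ∃ c₂ ∈ dualCode C₂,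
      (Function.support c₁ ∪ Function.support c₂).ncard ≤ r + 1 ∧
      j ∈ Function.support c₁ ∩ Function.support c₂) ∧
    ∀ E, E ∈ G ↔ ∃ a ∈ dualCode C₁, ∃ b ∈ dualCode C₂, E = opX a * opZ p b

/-- Optimality with respect to the quantum Singleton-like bound
`2 δ ≤ n - κ - 2 ⌈κ / r⌉ + 4`, which is a bound on the `[[n, κ, δ]]_q` codes with locality `r` that
come from the CSS construction: `Q(G)` is such a code and the bound holds with equality. -/
def IsSingletonOptimal (p : ℕ) [Fact p.Prime] [Algebra (ZMod p) F]
    (G : Subgroup (Qudits F n ≃ₗ[ℂ] Qudits F n)) (κ δ r : ℕ) : Prop :=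
  IsCSSWithLocality p G r ∧
  2 * (δ : ℤ) = (n : ℤ) - (κ : ℤ) - 2 * ⌈(κ : ℚ) / (r : ℚ)⌉ + 4

end Codes

end QLRC

end

set_option linter.unusedSectionVars false

noncomputable section

/-! A CSS group `{X(a) Z(b) : a ∈ A, b ∈ B}` with `A ≤ B^⊥` fixes exactly the `A`-invariant
functions supported on `B^⊥`, so its code is the space of functions on `B^⊥ / A`
(`stabilizerCodeCSSEquiv`). An error `X(a) Z(b)` is detected when `a ∉ B^⊥` or `b ∉ A^⊥`, and `X(w)`
is not detected when `w ∈ B^⊥ \ A`. The distance is thus read off from the classical codes.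

Let `α` list the `(r+1)`-th roots of unity in `F`. `A` is spanned by the indicators of `u` blocks of
length `r+1` and by the word repeating `α`; `B` is `A` multiplied by `α` in each block.
Orthogonality amounts to the vanishing of the power sums of degrees 1, 2, 3, which holds as `r+1 >
3`. Both codes have dimension `u+1`, hence `κ = u(r+1) - 2(u+1)`. Any two positions are separated by
the checks, so `A^⊥` and `B^⊥` have distance at least 3. A word of `B^⊥` of weight 3 inside one
block lies outside `A`, so the distance is exactly 3. The block indicators give the locality. -/

namespace QLRC

/-! ### Euclidean duality of linear codes. -/

section DualCode

variable {F : Type*} [Field F] {n : ℕ}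

/-- The standard bilinear form on `F^n`. -/
def dotForm (F : Type*) [Field F] (n : ℕ) : LinearMap.BilinForm F (Fin n → F) :=
  dotProductBilin F F

theorem dotForm_apply (x y : Fin n → F) : dotForm F n x y = x ⬝ᵥ y := rfl

theorem dotForm_isSymm : (dotForm F n).IsSymm :=
  ⟨fun x y => by simp [dotForm_apply, dotProduct_comm]⟩

theorem dotForm_nondegenerate : (dotForm F n).Nondegenerate := by
  refine ⟨fun x h => ?_, fun x h => ?_⟩ <;> ext i
  · simpa [dotForm_apply] using h (Pi.single i 1)
  · simpa [dotForm_apply] using h (Pi.single i 1)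

variable [Fintype F]

theorem mem_dualCode {C : Submodule F (Fin n → F)} {a : Fin n → F} :
    a ∈ dualCode C ↔ ∀ c ∈ C, a ⬝ᵥ c = 0 := Iff.rfl

theorem dualCode_eq_orthogonal (C : Submodule F (Fin n → F)) :
    dualCode C = (dotForm F n).orthogonal C := by
  ext a
  simp [mem_dualCode, LinearMap.BilinForm.mem_orthogonal_iff,  dotForm_apply, dotProduct_comm]

theorem dualCode_dualCode (C : Submodule F (Fin n → F)) : dualCode (dualCode C) = C := by
  rw [dualCode_eq_orthogonal, dualCode_eq_orthogonal,
    LinearMap.BilinForm.orthogonal_orthogonal dotForm_nondegenerate dotForm_isSymm.isRefl]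

theorem finrank_dualCode (C : Submodule F (Fin n → F)) :
    Module.finrank F (dualCode C) = n - Module.finrank F C := by
  rw [dualCode_eq_orthogonal, LinearMap.BilinForm.finrank_orthogonal dotForm_nondegenerate]
  simp

end DualCode

/-! ### Additive characters of `F`. -/

section Phase

variable {F : Type*} [Field F] [Fintype F] {n : ℕ} (p : ℕ) [Fact p.Prime] [Algebra (ZMod p) F]

theorem phase_add_right (b y z : Fin n → F) :
    phase p b (y + z) = phase p b y * phase p b z := by
  simp [phase, dotProduct_add, AddChar.map_add_eq_mul]

theorem phase_of_dotProduct_eq_zero {b z : Fin n → F} (h : b ⬝ᵥ z = 0) : phase p b z = 1 := by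
  simp [phase, h]

/-- The trace detects whether a scalar product vanishes, after rescaling. -/
theorem exists_phase_smul_ne_one {b z : Fin n → F} (h : b ⬝ᵥ z ≠ 0) :
    ∃ t : F, phase p (t • b) z ≠ 1 := by
  by_contra! H
  -- If every rescaling has trivial phase, the scalar product lies in the radical of the trace form,
  -- since the standard character of `ZMod p` is injective.
  refine h ((traceForm_nondegenerate (ZMod p) F).1 _ fun t => ?_)
  have ht := H t
  rwa [phase, smul_dotProduct, ← AddChar.map_zero_eq_one (ZMod.stdAddChar (N := p)),
    ZMod.injective_stdAddChar.eq_iff, smul_eq_mul, mul_comm, ← Algebra.traceForm_apply] at ht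

end Phase

/-! ### CSS stabilizer codes: dimension, detection, distance. -/

section CSS

variable {F : Type*} [Field F] [Fintype F] {n : ℕ} (p : ℕ) [Fact p.Prime] [Algebra (ZMod p) F]
  {A B : Submodule F (Fin n → F)}

theorem opX_mul_opZ (a b : Fin n → F) : opX a * opZ p b = errorOp p 0 a b := by
  ext ψ z
  rw [errorOp_apply]
  simp [opX, opZ]

/-- The stabilizer group `{X(a) Z(b) : a ∈ A, b ∈ B}` for orthogonal linear codes `A`, `B`. -/
def cssGroup (h : A ≤ dualCode B) : Subgroup (Qudits F n ≃ₗ[ℂ] Qudits F n) where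
  carrier := {E | ∃ a ∈ A, ∃ b ∈ B, E = opX a * opZ p b}
  mul_mem' := by
    rintro _ _ ⟨a, ha, b, hb, rfl⟩ ⟨c, hc, d, hd, rfl⟩
    refine ⟨a + c, A.add_mem ha hc, b + d, B.add_mem hb hd, ?_⟩
    simp only [opX_mul_opZ, errorOp_mul]
    -- The phase from commuting `Z(b)` past `X(c)` is trivial because `A` and `B` are orthogonal.
    rw [dotProduct_comm, h hc b hb]
    simp
  one_mem' := ⟨0, A.zero_mem, 0, B.zero_mem, by rw [opX_mul_opZ, errorOp_one]⟩
  inv_mem' := by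
    rintro _ ⟨a, ha, b, hb, rfl⟩
    refine ⟨-a, A.neg_mem ha, -b, B.neg_mem hb, ?_⟩
    rw [inv_eq_iff_mul_eq_one]
    simp only [opX_mul_opZ, errorOp_mul]
    rw [dotProduct_neg, dotProduct_comm, h ha b hb, ← errorOp_one p]
    congr 1 <;> simp

theorem mem_cssGroup (h : A ≤ dualCode B) {E : Qudits F n ≃ₗ[ℂ] Qudits F n} :
    E ∈ cssGroup p h ↔ ∃ a ∈ A, ∃ b ∈ B, E = opX a * opZ p b := Iff.rfl

theorem isStabilizerGroup_cssGroup (h : A ≤ dualCode B) :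
    IsStabilizerGroup p (cssGroup p h) := by
  constructor
  · rintro _ ⟨a, _, b, _, rfl⟩
    exact ⟨0, a, b, opX_mul_opZ p a b⟩
  · rintro _ ⟨a, ha, b, hb, rfl⟩ _ ⟨c, hc, d, hd, rfl⟩
    simp only [opX_mul_opZ, errorOp_mul]
    rw [dotProduct_comm, h hc b hb, dotProduct_comm, h ha d hd, add_comm a, add_comm b]

/-- The code of a CSS stabilizer group consists of the `A`-invariant functions supported on
`B^⊥`. -/
theorem mem_stabilizerCode_cssGroup (h : A ≤ dualCode B) {ψ : Qudits F n} :
    ψ ∈ stabilizerCode (cssGroup p h) ↔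
      (∀ a ∈ A, ∀ z, ψ (z + a) = ψ z) ∧ ∀ z, ψ z ≠ 0 → z ∈ dualCode B := by
  constructor
  · intro H
    have key : ∀ a ∈ A, ∀ b ∈ B, ∀ z, phase p b (z - a) * ψ (z - a) = ψ z := by
      intro a ha b hb z
      have := H (opX a * opZ p b) ⟨a, ha, b, hb, rfl⟩
      rw [opX_mul_opZ] at this
      have h2 := errorOp_apply p 0 a b ψ z
      rw [this] at h2
      simpa using h2.symm
    constructor
    · intro a ha z
      have := key a ha 0 B.zero_mem (z + a)
      simpa [phase_zero_left] using this.symm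
    · intro z hz b hb
      by_contra hne
      rw [dotProduct_comm] at hne
      obtain ⟨t, ht⟩ := exists_phase_smul_ne_one p hne
      -- Pure `Z` stabilizers multiply `ψ z` by a phase, which must be 1 wherever `ψ z ≠ 0`.
      have := key 0 A.zero_mem _ (B.smul_mem t hb) z
      rw [sub_zero] at this
      exact ht ((mul_eq_right₀ hz).1 this)
  · rintro ⟨H1, H2⟩ _ ⟨a, ha, b, hb, rfl⟩
    ext z
    rw [opX_mul_opZ, errorOp_apply, AddChar.map_zero_eq_one, one_mul]
    have e : ψ (z - a) = ψ z := by simpa using (H1 a ha (z - a)).symm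
    rw [e]
    by_cases hz : ψ z = 0
    · simp [hz]
    · rw [phase_of_dotProduct_eq_zero, one_mul]
      rw [dotProduct_comm]
      exact (dualCode B).sub_mem (H2 z hz) (h ha) b hb

/-- A codeword of a CSS code is a function on `B^⊥ / A`. -/
def stabilizerCodeCSSEquiv (h : A ≤ dualCode B) :
    stabilizerCode (cssGroup p h) ≃ₗ[ℂ] ((dualCode B ⧸ A.submoduleOf (dualCode B)) → ℂ) where
  toFun ψ := Quotient.lift (fun z : dualCode B => ψ.1 z) (by
    intro x y hxy
    have hxy : (x - y : Fin n → F) ∈ A := 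
      (Submodule.quotientRel_def (A.submoduleOf (dualCode B))).1 hxy
    have := ((mem_stabilizerCode_cssGroup p h).1 ψ.2).1 _ hxy y
    simpa using this)
  map_add' _ _ := by ext ⟨z⟩; rfl
  map_smul' _ _ := by ext ⟨z⟩; rfl
  invFun f := ⟨WithLp.toLp 2 fun z => by
      classical exact if hz : z ∈ dualCode B then f (Submodule.Quotient.mk ⟨z, hz⟩) else 0, by
    rw [mem_stabilizerCode_cssGroup]
    refine ⟨fun a ha z => ?_, fun z hz => ?_⟩
    · by_cases hz : z ∈ dualCode B
      · have hza : z + a ∈ dualCode B := add_mem hz (h ha)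
        simp only [hz, hza, dif_pos]
        congr 1
        rw [Submodule.Quotient.eq]
        change z + a - z ∈ A
        simpa using ha
      · have hza : z + a ∉ dualCode B := fun H => hz (by simpa using sub_mem H (h ha))
        simp [hz, hza]
    · by_contra hn
      simp [hn] at hz⟩
  left_inv ψ := by
    ext z
    by_cases hz : z ∈ dualCode B
    · simp only [hz, dif_pos]
      rfl
    · simp only [hz, dif_neg, not_false_eq_true]
      by_contra hn
      exact hz (((mem_stabilizerCode_cssGroup p h).1 ψ.2).2 z (Ne.symm hn))
  right_inv f := by
    ext ⟨z, hz⟩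
    exact dif_pos hz

/-- The dimension is the number of cosets in `B^⊥ / A`. -/
theorem finrank_stabilizerCode_cssGroup (h : A ≤ dualCode B) :
    Module.finrank ℂ (stabilizerCode (cssGroup p h)) =
      Fintype.card F ^ (n - Module.finrank F B - Module.finrank F A) := by
  classical
  rw [(stabilizerCodeCSSEquiv p h).finrank_eq, Module.finrank_fintype_fun_eq_card,
    ← Nat.card_eq_fintype_card, Module.natCard_eq_pow_finrank (K := F),
    Nat.card_eq_fintype_card, Submodule.finrank_quotient, finrank_dualCode,
    (Submodule.submoduleOfEquivOfLe h).finrank_eq]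

theorem inner_errorOp (φ ψ : Qudits F n) (i : ZMod p) (a b : Fin n → F) :
    inner ℂ φ (errorOp p i a b ψ) = ∑ z, (starRingEnd ℂ) (φ z) *
      (ZMod.stdAddChar i * (phase p b (z - a) * ψ (z - a))) := by
  rw [PiLp.inner_apply]
  refine Finset.sum_congr rfl fun z _ => ?_
  rw [errorOp_apply, RCLike.inner_apply, mul_comm]

/-- The shift by `a` moves `B^⊥` to a disjoint coset, so shifted codewords and codewords have
disjoint supports. -/
theorem detects_errorOp_of_notMem_left (h : A ≤ dualCode B) (i : ZMod p) {a : Fin n → F}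
    (b : Fin n → F) (ha : a ∉ dualCode B) :
    Detects (stabilizerCode (cssGroup p h)) (errorOp p i a b) := by
  refine ⟨0, fun φ hφ ψ hψ => ?_⟩
  rw [inner_errorOp, zero_mul]
  refine Finset.sum_eq_zero fun z _ => ?_
  by_cases h1 : φ z = 0
  · simp [h1]
  by_cases h2 : ψ (z - a) = 0
  · simp [h2]
  refine absurd ?_ ha
  simpa using sub_mem (((mem_stabilizerCode_cssGroup p h).1 hφ).2 _ h1)
    (((mem_stabilizerCode_cssGroup p h).1 hψ).2 _ h2)

/-- Translating the summation variable by a multiple of a word of `A` not orthogonal to `b` leaves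
the codewords unchanged but multiplies the matrix element by a nontrivial phase, so it vanishes. -/
theorem detects_errorOp_of_notMem_right (h : A ≤ dualCode B) (i : ZMod p) (a : Fin n → F)
    {b : Fin n → F} (hb : b ∉ dualCode A) :
    Detects (stabilizerCode (cssGroup p h)) (errorOp p i a b) := by
  refine ⟨0, fun φ hφ ψ hψ => ?_⟩
  rw [zero_mul]
  obtain ⟨c, hc, hbc⟩ : ∃ c ∈ A, c ⬝ᵥ b ≠ 0 := by
    simpa [mem_dualCode, dotProduct_comm] using hb
  obtain ⟨t, ht⟩ := exists_phase_smul_ne_one p hbc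
  have ht' : phase p b (t • c) ≠ 1 := by
    rwa [phase, dotProduct_comm, ← phase]
  have htc := A.smul_mem t hc
  have key : inner ℂ φ (errorOp p i a b ψ) =
      phase p b (t • c) * inner ℂ φ (errorOp p i a b ψ) := by
    rw [inner_errorOp, Finset.mul_sum, ← Equiv.sum_comp (Equiv.addRight (t • c))]
    refine Finset.sum_congr rfl fun z _ => ?_
    have e : z + t • c - a = z - a + t • c := by abel
    rw [Equiv.coe_addRight, e, ((mem_stabilizerCode_cssGroup p h).1 hφ).1 _ htc,
      ((mem_stabilizerCode_cssGroup p h).1 hψ).1 _ htc, phase_add_right]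
    ring
  by_contra hne
  exact ht' ((mul_eq_right₀ hne).1 key.symm)

theorem detects_errorOp_zero (Q : Submodule ℂ (Qudits F n)) (i : ZMod p) :
    Detects Q (errorOp p i 0 0) := by
  refine ⟨ZMod.stdAddChar i, fun φ _ ψ _ => ?_⟩
  rw [inner_errorOp, PiLp.inner_apply, Finset.mul_sum]
  refine Finset.sum_congr rfl fun z _ => ?_
  rw [RCLike.inner_apply, phase_zero_left, sub_zero]
  ring

/-- A shift by a word of `B^⊥` outside `A` moves the uniform superposition over `A` to an orthogonal
codeword. -/
theorem not_detects_errorOp (h : A ≤ dualCode B) {w : Fin n → F} (hw : w ∈ dualCode B)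
    (hwA : w ∉ A) : ¬ Detects (stabilizerCode (cssGroup p h)) (errorOp p 0 w 0) := by
  classical
  rintro ⟨lam, H⟩
  let ψ : Qudits F n := WithLp.toLp 2 fun z => if z ∈ A then 1 else 0
  let φ : Qudits F n := WithLp.toLp 2 fun z => if z - w ∈ A then 1 else 0
  have hψ : ψ ∈ stabilizerCode (cssGroup p h) := by
    rw [mem_stabilizerCode_cssGroup]
    refine ⟨fun a ha z => ?_, fun z hz => h ?_⟩
    · simp [ψ, A.add_mem_iff_left ha]
    · simpa [ψ] using hz
  have hφ : φ ∈ stabilizerCode (cssGroup p h) := by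
    rw [mem_stabilizerCode_cssGroup]
    refine ⟨fun a ha z => ?_, fun z hz => ?_⟩
    · simp [φ, add_sub_right_comm, A.add_mem_iff_left ha]
    · have hz : z - w ∈ A := by simpa [φ] using hz
      simpa using add_mem (h hz) hw
  have h0 : inner ℂ φ ψ = 0 := by
    rw [PiLp.inner_apply]
    refine Finset.sum_eq_zero fun z _ => ?_
    by_cases h1 : z ∈ A
    · have h2 : z - w ∉ A := fun h2 => hwA (by simpa using sub_mem h1 h2)
      simp [φ, h2]
    · simp [ψ, h1]
  have h1 := H φ hφ ψ hψ
  rw [h0, mul_zero, inner_errorOp] at h1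
  -- The error sends `ψ` to `φ`, so the matrix element counts the coset `w + A`, which contains `w`;
  -- orthogonality of `φ` and `ψ` would force it to be zero.
  have h2 : ∀ z, (starRingEnd ℂ) (φ z) * (ZMod.stdAddChar (0 : ZMod p) *
      (phase p 0 (z - w) * ψ (z - w))) = if z - w ∈ A then 1 else 0 := by
    intro z
    by_cases hz : z - w ∈ A <;> simp [φ, ψ, hz, phase_zero_left]
  simp only [h2, Finset.sum_boole, Nat.cast_eq_zero, Finset.card_eq_zero] at h1
  have : w ∈ ({z | z - w ∈ A} : Finset (Fin n → F)) := by simp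
  simp [h1] at this

/-- A CSS code for which both `A^⊥` and `B^⊥` have minimum distance at least `δ`, and `B^⊥` has a
word of weight `δ` outside `A`, has minimum distance `δ`. -/
theorem hasMinDist_stabilizerCode_cssGroup (h : A ≤ dualCode B) {δ : ℕ}
    (hA : ∀ c ∈ dualCode A, (Function.support c).ncard < δ → c = 0)
    (hB : ∀ c ∈ dualCode B, (Function.support c).ncard < δ → c = 0)
    {w : Fin n → F} (hw : w ∈ dualCode B) (hwA : w ∉ A)
    (hwδ : (Function.support w).ncard = δ) :
    HasMinDist p (stabilizerCode (cssGroup p h)) δ := by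
  refine ⟨fun i a b hab => ?_, 0, w, 0, ?_, not_detects_errorOp p h hw hwA⟩
  · by_cases ha : a ∈ dualCode B
    · by_cases hb : b ∈ dualCode A
      · have ha0 : a = 0 := hB a ha
          ((Set.ncard_le_ncard (fun i hi => Or.inl hi) (Set.toFinite _)).trans_lt hab)
        have hb0 : b = 0 := hA b hb
          ((Set.ncard_le_ncard (fun i hi => Or.inr hi) (Set.toFinite _)).trans_lt hab)
        rw [ha0, hb0]
        exact detects_errorOp_zero p _ i
      · exact detects_errorOp_of_notMem_right p h i a hb
    · exact detects_errorOp_of_notMem_left p h i b ha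
  · rw [← hwδ]
    congr 1
    ext i
    simp [qsupp]

end CSS

/-! ### The classical block codes. -/

section BlockCode

variable {F : Type*} [Field F] {u m : ℕ}

/-- The index of the block of length `m` that contains a position. -/
def blockIdx (i : Fin (u * m)) : Fin u := (finProdFinEquiv.symm i).1

/-- The place of a position inside its block of length `m`. -/
def blockPos (i : Fin (u * m)) : Fin m := (finProdFinEquiv.symm i).2

theorem blockIdx_mk (j : Fin u) (k : Fin m) : blockIdx (finProdFinEquiv (j, k)) = j := by
  simp [blockIdx]

theorem blockPos_mk (j : Fin u) (k : Fin m) : blockPos (finProdFinEquiv (j, k)) = k := by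
  simp [blockPos]

theorem eq_of_blockIdx_eq {i j : Fin (u * m)} (h : blockIdx i = blockIdx j)
    (h' : blockPos i = blockPos j) : i = j :=
  finProdFinEquiv.symm.injective (Prod.ext h h')

theorem ncard_block_le (j : Fin u) : {i : Fin (u * m) | blockIdx i = j}.ncard ≤ m := by
  have : {i : Fin (u * m) | blockIdx i = j} ⊆
      (fun k : Fin m => finProdFinEquiv (j, k)) '' Set.univ := by
    rintro i rfl
    exact ⟨blockPos i, trivial, finProdFinEquiv.apply_symm_apply i⟩
  refine (Set.ncard_le_ncard this (Set.toFinite _)).trans ((Set.ncard_image_le).trans ?_)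
  simp [Set.ncard_univ]

variable (α v : Fin m → F)

/-- The encoder of the code of length `u * m` that is checked, in coordinates rescaled by `v`,
by the indicators of the blocks and by the word repeating `α` in each block. -/
def blockEncoder (u : ℕ) : (Fin u → F) × F →ₗ[F] (Fin (u * m) → F) where
  toFun c i := v (blockPos i) * (c.1 (blockIdx i) + c.2 * α (blockPos i))
  map_add' _ _ := by ext i; simp; ring
  map_smul' _ _ := by ext i; simp; ring

theorem blockEncoder_apply (s : Fin u → F) (t : F) (i : Fin (u * m)) :
    blockEncoder α v u (s, t) i =
      v (blockPos i) * (s (blockIdx i) + t * α (blockPos i)) := rfl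

/-- The linear code spanned by the indicators of the blocks and the word repeating `α` in each
block, rescaled by `v` in each block. -/
def blockCode (u : ℕ) : Submodule F (Fin (u * m) → F) := LinearMap.range (blockEncoder α v u)

theorem mem_blockCode {c : Fin (u * m) → F} :
    c ∈ blockCode α v u ↔ ∃ s t, blockEncoder α v u (s, t) = c := by
  simp [blockCode]

variable {α v}

theorem sum_block (f : Fin (u * m) → F) :
    ∑ i, f i = ∑ j : Fin u, ∑ k : Fin m, f (finProdFinEquiv (j, k)) := by
  rw [← finProdFinEquiv.sum_comp, Fintype.sum_prod_type]

theorem finrank_blockCode (hα : Function.Injective α) (hv : ∀ k, v k ≠ 0) (hu : 0 < u)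
    (hm : 2 ≤ m) : Module.finrank F (blockCode α v u) = u + 1 := by
  rw [blockCode, LinearMap.finrank_range_of_inj]
  · simp
  rw [← LinearMap.ker_eq_bot, LinearMap.ker_eq_bot']
  rintro ⟨s, t⟩ h
  have key : ∀ j k, s j + t * α k = 0 := fun j k => by
    have := congrFun h (finProdFinEquiv (j, k))
    rw [blockEncoder_apply, blockIdx_mk, blockPos_mk] at this
    exact (mul_eq_zero.1 this).resolve_left (hv k)
  have ht : t = 0 := by
    have h0 := key ⟨0, hu⟩ ⟨0, by omega⟩
    have h1 := key ⟨0, hu⟩ ⟨1, by omega⟩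
    have h2 : t * (α ⟨1, by omega⟩ - α ⟨0, by omega⟩) = 0 := by linear_combination h1 - h0
    refine (mul_eq_zero.1 h2).resolve_right (sub_ne_zero.2 fun e => ?_)
    simpa using hα e
  subst ht
  refine Prod.ext (funext fun j => ?_) rfl
  simpa using key j ⟨0, by omega⟩

/-- Every position is covered by a word of a block code that takes the value one there and is
supported on the block of the position. -/
theorem exists_mem_blockCode_local (α : Fin m → F) (hv : ∀ k, v k ≠ 0) (i : Fin (u * m)) :
    ∃ c ∈ blockCode α v u, c i = 1 ∧
      Function.support c ⊆ {l | blockIdx l = blockIdx i} := by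
  refine ⟨_, ⟨(Pi.single (blockIdx i) (v (blockPos i))⁻¹, 0), rfl⟩, ?_, ?_⟩
  · simp [blockEncoder_apply, hv]
  · intro l hl
    by_contra h
    have h : blockIdx l ≠ blockIdx i := h
    exact hl (by simp [blockEncoder_apply, h])

variable [Fintype F]

/-- Within a block, the product of two words is `v * v'` times a polynomial of degree at most 2 in
`α`, so three moments suffice. -/
theorem blockCode_le_dualCode {v' : Fin m → F} (h0 : ∑ k, v k * v' k = 0)
    (h1 : ∑ k, v k * v' k * α k = 0) (h2 : ∑ k, v k * v' k * α k ^ 2 = 0) :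
    blockCode α v u ≤ dualCode (blockCode α v' u) := by
  intro a ha b hb
  obtain ⟨s, t, rfl⟩ := (mem_blockCode α v).1 ha
  obtain ⟨s', t', rfl⟩ := (mem_blockCode α v').1 hb
  rw [dotProduct, sum_block]
  refine Finset.sum_eq_zero fun j _ => ?_
  have : ∀ k : Fin m, blockEncoder α v u (s, t) (finProdFinEquiv (j, k)) *
      blockEncoder α v' u (s', t') (finProdFinEquiv (j, k)) = s j * s' j * (v k * v' k) +
        (s j * t' + t * s' j) * (v k * v' k * α k) + t * t' * (v k * v' k * α k ^ 2) := by
    intro k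
    rw [blockEncoder_apply, blockEncoder_apply, blockIdx_mk, blockPos_mk]
    ring
  rw [Finset.sum_congr rfl fun k _ => this k, Finset.sum_add_distrib, Finset.sum_add_distrib,
    ← Finset.mul_sum, ← Finset.mul_sum, ← Finset.mul_sum, h0, h1, h2]
  simp

theorem exists_mem_blockCode_separating (hα : Function.Injective α) (hv : ∀ k, v k ≠ 0)
    {i j : Fin (u * m)} (hij : i ≠ j) : ∃ c ∈ blockCode α v u, c i ≠ 0 ∧ c j = 0 := by
  by_cases h : blockIdx i = blockIdx j
  · refine ⟨_, ⟨(fun _ => -α (blockPos j), 1), rfl⟩, ?_, ?_⟩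
    · rw [blockEncoder_apply]
      refine mul_ne_zero (hv _) fun h0 => hij (eq_of_blockIdx_eq h (hα ?_))
      linear_combination h0
    · simp [blockEncoder_apply]
  · refine ⟨_, ⟨(Pi.single (blockIdx i) 1, 0), rfl⟩, ?_, ?_⟩
    · simp [blockEncoder_apply, hv]
    · simp [blockEncoder_apply, Ne.symm h]

/-- The dual of a block code has minimum distance at least three. -/
theorem eq_zero_of_mem_dualCode_blockCode (hα : Function.Injective α) (hv : ∀ k, v k ≠ 0)
    {c : Fin (u * m) → F} (hc : c ∈ dualCode (blockCode α v u))
    (hw : (Function.support c).ncard < 3) : c = 0 := by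
  ext i
  by_contra hi
  -- A vanishing scalar product cannot have exactly one nonzero term. Applied to a check through
  -- `i`, this yields a second support position `j`; applied to a check that separates `i` from `j`,
  -- a third.
  have key : ∀ w ∈ blockCode α v u, w i ≠ 0 → ∃ k ≠ i, c k ≠ 0 ∧ w k ≠ 0 := by
    intro w hw hwi
    by_contra! H
    have h := hc w hw
    rw [dotProduct, Finset.sum_eq_single i _ (by simp)] at h
    · exact mul_ne_zero hi hwi h
    · intro k _ hki
      by_cases hk : c k = 0
      · rw [hk, zero_mul]
      · rw [H k hki hk, mul_zero]
  obtain ⟨w₁, hw₁, hwi₁, -⟩ := exists_mem_blockCode_local α hv i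
  obtain ⟨j, hji, hj, -⟩ := key w₁ hw₁ (by simp [hwi₁])
  obtain ⟨w₂, hw₂, hwi₂, hwj₂⟩ := exists_mem_blockCode_separating hα hv hji.symm
  obtain ⟨k, hki, hk, hwk⟩ := key w₂ hw₂ hwi₂
  have hkj : k ≠ j := fun e => hwk (e ▸ hwj₂)
  have hsub : {i, j, k} ⊆ Function.support c := by
    rintro l (rfl | rfl | rfl) <;> assumption
  have h3 : ({i, j, k} : Set (Fin (u * m))).ncard = 3 :=
    Set.ncard_eq_three.2 ⟨i, j, k, hji.symm, hki.symm, hkj.symm, rfl⟩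
  have := Set.ncard_le_ncard hsub (Set.toFinite _)
  omega

/-- The dual of a block code has a word of weight three supported on the first three places of a
block. -/
theorem exists_mem_dualCode_blockCode (hα : Function.Injective α) (hv : ∀ k, v k ≠ 0)
    (hu : 0 < u) {k₀ k₁ k₂ : Fin m} (h01 : k₀ ≠ k₁) (h02 : k₀ ≠ k₂) (h12 : k₁ ≠ k₂) :
    ∃ c ∈ dualCode (blockCode α v u), (Function.support c).ncard = 3 ∧
      Function.support c = (fun k => finProdFinEquiv ((⟨0, hu⟩ : Fin u), k)) '' {k₀, k₁, k₂} := by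
  classical
  let P : Fin m → Fin (u * m) := fun k => finProdFinEquiv ((⟨0, hu⟩ : Fin u), k)
  have hP : Function.Injective P := fun k l h => by simpa [P] using h
  -- Up to the factors `v⁻¹`, these coefficients are the linear relation between the vectors `(1, α
  -- k)` at the three places.
  let c : Fin (u * m) → F := Pi.single (P k₀) ((v k₀)⁻¹ * (α k₁ - α k₂)) +
    Pi.single (P k₁) ((v k₁)⁻¹ * (α k₂ - α k₀)) + Pi.single (P k₂) ((v k₂)⁻¹ * (α k₀ - α k₁))
  have hsupp : Function.support c = P '' {k₀, k₁, k₂} := by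
    have h0 : (v k₀)⁻¹ * (α k₁ - α k₂) ≠ 0 :=
      mul_ne_zero (inv_ne_zero (hv _)) (sub_ne_zero.2 (hα.ne h12))
    have h1 : (v k₁)⁻¹ * (α k₂ - α k₀) ≠ 0 :=
      mul_ne_zero (inv_ne_zero (hv _)) (sub_ne_zero.2 (hα.ne h02.symm))
    have h2 : (v k₂)⁻¹ * (α k₀ - α k₁) ≠ 0 :=
      mul_ne_zero (inv_ne_zero (hv _)) (sub_ne_zero.2 (hα.ne h01))
    ext i
    rw [Set.image_insert_eq, Set.image_pair, Function.mem_support]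
    simp only [Set.mem_insert_iff, Set.mem_singleton_iff, c, Pi.add_apply]
    by_cases e0 : i = P k₀
    · subst e0
      simpa [Pi.single_apply, hP.eq_iff, h01, h02] using h0
    by_cases e1 : i = P k₁
    · subst e1
      simpa [Pi.single_apply, hP.eq_iff, h01.symm, h12] using h1
    by_cases e2 : i = P k₂
    · subst e2
      simpa [Pi.single_apply, hP.eq_iff, h02.symm, h12.symm] using h2
    simp [e0, e1, e2]
  refine ⟨c, fun b hb => ?_, ?_, hsupp⟩
  · obtain ⟨s, t, rfl⟩ := (mem_blockCode α v).1 hb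
    simp only [c, add_dotProduct, single_dotProduct, blockEncoder_apply, P, blockIdx_mk,
      blockPos_mk]
    have h0 := hv k₀
    have h1 := hv k₁
    have h2 := hv k₂
    field_simp
    ring
  · rw [hsupp, Set.ncard_image_of_injective _ hP, Set.ncard_eq_three]
    exact ⟨_, _, _, h01, h02, h12, rfl⟩

/-- A word of a block code that vanishes at two places of a block vanishes on the block. -/
theorem eq_zero_of_mem_blockCode (hα : Function.Injective α) (hv : ∀ k, v k ≠ 0)
    {c : Fin (u * m) → F} (hc : c ∈ blockCode α v u) (j : Fin u) {k l : Fin m} (hkl : k ≠ l)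
    (hk : c (finProdFinEquiv (j, k)) = 0) (hl : c (finProdFinEquiv (j, l)) = 0) (i : Fin m) :
    c (finProdFinEquiv (j, i)) = 0 := by
  obtain ⟨s, t, rfl⟩ := (mem_blockCode α v).1 hc
  rw [blockEncoder_apply, blockIdx_mk, blockPos_mk] at *
  replace hk := (mul_eq_zero.1 hk).resolve_left (hv k)
  replace hl := (mul_eq_zero.1 hl).resolve_left (hv l)
  have ht : t = 0 := by
    have : t * (α k - α l) = 0 := by linear_combination hk - hl
    exact (mul_eq_zero.1 this).resolve_right (sub_ne_zero.2 (hα.ne hkl))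
  subst ht
  rw [zero_mul, add_zero] at *
  rw [hk, mul_zero]

end BlockCode

/-! ### Locality of the CSS codes built from block codes. -/

section BlockCSS

variable {F : Type*} [Field F] [Fintype F] (p : ℕ) [Fact p.Prime] [Algebra (ZMod p) F] {u m : ℕ}
  {α v v' : Fin m → F}

theorem hasLocality_cssGroup_blockCode (hv : ∀ k, v k ≠ 0) (hv' : ∀ k, v' k ≠ 0)
    (h : blockCode α v u ≤ dualCode (blockCode α v' u)) {r : ℕ} (hr : m ≤ r + 1) :
    HasLocality p (cssGroup p h) r := by
  intro i
  obtain ⟨a, ha, hai, has⟩ := exists_mem_blockCode_local α hv i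
  obtain ⟨b, hb, hbi, hbs⟩ := exists_mem_blockCode_local α hv' i
  refine ⟨a, 0, 0, b, ⟨a, ha, 0, zero_mem _, rfl⟩, ⟨0, zero_mem _, b, hb, rfl⟩, ?_,
    ⟨hai, rfl⟩, rfl, hbi⟩
  refine (Set.ncard_le_ncard (Set.union_subset ?_ ?_) (Set.toFinite _)).trans
    ((ncard_block_le (blockIdx i)).trans hr)
  · exact fun l hl => has (by simpa [qsupp] using hl)
  · exact fun l hl => hbs (by simpa [qsupp] using hl)

theorem isCSSWithLocality_cssGroup_blockCode (hv : ∀ k, v k ≠ 0) (hv' : ∀ k, v' k ≠ 0)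
    (h : blockCode α v u < dualCode (blockCode α v' u)) {r : ℕ} (hr : m ≤ r + 1) :
    IsCSSWithLocality p (cssGroup p h.le) r := by
  refine ⟨dualCode (blockCode α v u), dualCode (blockCode α v' u), ?_, fun i => ?_, fun E => ?_⟩
  · rwa [dualCode_dualCode]
  · rw [dualCode_dualCode, dualCode_dualCode]
    obtain ⟨a, ha, hai, has⟩ := exists_mem_blockCode_local α hv i
    obtain ⟨b, hb, hbi, hbs⟩ := exists_mem_blockCode_local α hv' i
    refine ⟨a, ha, b, hb, ?_, by simp [hai], by simp [hbi]⟩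
    exact (Set.ncard_le_ncard (Set.union_subset has hbs) (Set.toFinite _)).trans
      ((ncard_block_le (blockIdx i)).trans hr)
  · rw [dualCode_dualCode, dualCode_dualCode, mem_cssGroup]

end BlockCSS

/-! ### Roots of unity and the Singleton-like equality. -/

/-- The power sums of the `m`-th roots of unity vanish in degrees that are not multiples of `m`. -/
theorem sum_primitiveRoot_pow {F : Type*} [Field F] {m : ℕ} {ζ : F} (hζ : IsPrimitiveRoot ζ m)
    {e : ℕ} (he : ¬ m ∣ e) : ∑ k : Fin m, (ζ ^ (k : ℕ)) ^ e = 0 := by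
  have h1 : ζ ^ e ≠ 1 := fun h => he (hζ.dvd_of_pow_eq_one e h)
  have h2 : ∀ k : Fin m, (ζ ^ (k : ℕ)) ^ e = (ζ ^ e) ^ (k : ℕ) := fun k => pow_right_comm _ _ _
  rw [Finset.sum_congr rfl fun k _ => h2 k, Fin.sum_univ_eq_sum_range (fun k => (ζ ^ e) ^ k),
    geom_sum_eq h1, pow_right_comm, hζ.pow_eq_one]
  simp

theorem exists_isPrimitiveRoot_of_dvd_card_sub_one {F : Type*} [Field F] [Fintype F] {m : ℕ}
    (h : m ∣ Fintype.card F - 1) : ∃ ζ : F, IsPrimitiveRoot ζ m := by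
  classical
  obtain ⟨g, hg⟩ := IsCyclic.exists_ofOrder_eq_natCard (α := Fˣ)
  rw [Nat.card_eq_fintype_card, Fintype.card_units] at hg
  have hpos : 0 < Fintype.card F - 1 := Nat.sub_pos_of_lt Fintype.one_lt_card
  obtain ⟨d, hd⟩ := h
  refine ⟨((g ^ d : Fˣ) : F), IsPrimitiveRoot.coe_units_iff.2 ?_⟩
  refine (IsPrimitiveRoot.orderOf g).pow (hg ▸ hpos) ?_
  rw [hg, hd, mul_comm]

/-- Since `κ = u * r - (u + 2)` and `0 < u + 2 < r`, the ceiling of `κ / r` is `u`. -/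
theorem singleton_bound_eq {u r : ℕ} (hu : 0 < u) (hur : u + 2 < r) :
    2 * ((3 : ℕ) : ℤ) = ((u * (r + 1) : ℕ) : ℤ) - ((u * (r - 1) - 2 : ℕ) : ℤ) -
      2 * ⌈((u * (r - 1) - 2 : ℕ) : ℚ) / (r : ℚ)⌉ + 4 := by
  obtain ⟨s, rfl⟩ : ∃ s, r = s + 1 := ⟨r - 1, by omega⟩
  -- This makes the natural subtraction in `κ` genuine.
  have hle : 2 ≤ u * s := by nlinarith
  have hceil : ⌈((u * (s + 1 - 1) - 2 : ℕ) : ℚ) / ((s + 1 : ℕ) : ℚ)⌉ = u := by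
    rw [Int.ceil_eq_iff, Nat.add_sub_cancel, Nat.cast_sub hle]
    have h3 : (u : ℚ) + 2 < s + 1 := by exact_mod_cast hur
    have hs : (0 : ℚ) < s + 1 := by positivity
    push_cast
    rw [lt_div_iff₀ hs, div_le_iff₀ hs]
    constructor <;> nlinarith
  rw [hceil, Nat.add_sub_cancel, Nat.cast_sub hle]
  push_cast
  ring

end QLRC

end

/-! ### The optimal code. -/

theorem theorem4p6 (p q u r : ℕ) [Fact p.Prime] (F : Type*) [Field F] [Fintype F]
    [Algebra (ZMod p) F] (hq : Fintype.card F = q) (hu : 0 < u) (hr : 0 < r)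
    (hur : u + 2 < r) (huq : Nat.gcd u q = 1) (hrq : r + 1 ∣ q - 1)
    (hgcd : Nat.gcd u (q - 1) ∣ 2 * (q - 1) / (r + 1)) :
    ∃ G : Subgroup (QLRC.Qudits F (u * (r + 1)) ≃ₗ[ℂ] QLRC.Qudits F (u * (r + 1))),
      QLRC.IsStabilizerGroup p G ∧
      QLRC.IsQuantumCode p (QLRC.stabilizerCode G) (u * (r - 1) - 2) 3 ∧
      QLRC.HasLocality p G r ∧
      QLRC.IsSingletonOptimal p G (u * (r - 1) - 2) 3 r := by
  subst hq
  obtain ⟨ζ, hζ⟩ := QLRC.exists_isPrimitiveRoot_of_dvd_card_sub_one hrq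
  let α : Fin (r + 1) → F := fun k => ζ ^ (k : ℕ)
  have hα : Function.Injective α := fun k l h => Fin.ext (hζ.pow_inj k.2 l.2 h)
  have hα0 : ∀ k, α k ≠ 0 := fun k => pow_ne_zero _ (hζ.ne_zero (Nat.succ_ne_zero r))
  have h10 : ∀ k : Fin (r + 1), (1 : Fin (r + 1) → F) k ≠ 0 := fun k => one_ne_zero
  have hsum : ∀ e, 0 < e → e < r + 1 → ∑ k, α k ^ e = 0 := fun e he her =>
    QLRC.sum_primitiveRoot_pow hζ (Nat.not_dvd_of_pos_of_lt he her)
  -- The scalings `1` and `α` shift the needed moments from degrees 0, 1, 2 to 1, 2, 3; the sum of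
  -- degree 0 is `r + 1`, which is nonzero in `F`.
  have hle : QLRC.blockCode α 1 u ≤ QLRC.dualCode (QLRC.blockCode α α u) := by
    apply QLRC.blockCode_le_dualCode
    · simpa using hsum 1 (by omega) (by omega)
    · simpa [← pow_two] using hsum 2 (by omega) (by omega)
    · simpa [← pow_succ'] using hsum 3 (by omega) (by omega)
  obtain ⟨w, hw, hw3, hws⟩ := QLRC.exists_mem_dualCode_blockCode (v := α) hα hα0 hu
    (k₀ := ⟨0, by omega⟩) (k₁ := ⟨1, by omega⟩) (k₂ := ⟨2, by omega⟩)
    (by simp) (by simp) (by simp)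
  have hw_out : ∀ k : Fin (r + 1), 3 ≤ (k : ℕ) → w (finProdFinEquiv (⟨0, hu⟩, k)) = 0 := by
    intro k hk
    rw [← Function.notMem_support, hws]
    rintro ⟨l, hl, e⟩
    obtain rfl : l = k := by simpa using e
    simp only [Set.mem_insert_iff, Set.mem_singleton_iff, Fin.ext_iff] at hl
    omega
  have hwA : w ∉ QLRC.blockCode α 1 u := by
    intro hwA
    -- As `r + 1 ≥ 5`, the block has places 3 and 4, where `w` vanishes; membership in `A` would
    -- then kill its nonzero entry at place 0.
    have h0 := QLRC.eq_zero_of_mem_blockCode hα h10 hwA ⟨0, hu⟩ (k := ⟨3, by omega⟩)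
      (l := ⟨4, by omega⟩) (by simp) (hw_out _ le_rfl) (hw_out _ (by simp)) ⟨0, by omega⟩
    rw [← Function.notMem_support, hws] at h0
    exact h0 ⟨_, Set.mem_insert _ _, rfl⟩
  have hlt := lt_of_le_of_ne hle fun e => hwA (e ▸ hw)
  refine ⟨QLRC.cssGroup p hle, QLRC.isStabilizerGroup_cssGroup p hle, ⟨?_, ?_⟩,
    QLRC.hasLocality_cssGroup_blockCode p h10 hα0 hle le_rfl,
    QLRC.isCSSWithLocality_cssGroup_blockCode p h10 hα0 hlt le_rfl,
    QLRC.singleton_bound_eq hu hur⟩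
  · rw [QLRC.finrank_stabilizerCode_cssGroup, QLRC.finrank_blockCode hα h10 hu (by omega),
      QLRC.finrank_blockCode hα hα0 hu (by omega)]
    congr 1
    obtain ⟨s, rfl⟩ : ∃ s, r = s + 1 := ⟨r - 1, by omega⟩
    rw [Nat.add_sub_cancel, mul_add, mul_add]
    omega
  · exact QLRC.hasMinDist_stabilizerCode_cssGroup p hle
      (fun c hc => QLRC.eq_zero_of_mem_dualCode_blockCode hα h10 hc)
      (fun c hc => QLRC.eq_zero_of_mem_dualCode_blockCode hα hα0 hc) hw hwA hw3
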